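/- Let $\Omega\subset\mathbb R^d$ be a bounded open set and let $k$ be a real kernel which is symmetric ($k(x,y)=k(y,x)$ for all $x\ne y$ in $\overline\Omega$) and either continuous on $\overline\Omega\times\overline\Omega$, or weakly singular with some $\alpha\in[0,d/2)$, i.e. continuous on $\{(x,y)\in\overline\Omega\times\overline\Omega: x\neq y\}$ with $|k(x,y)|\le C|x-y|^{-\alpha}$ there for some $C>0$. Let $(Au)(x)=\int_\Omega k(x,y)u(y)\,dy$ for $u\in L^2(\Omega)$ (real-valued functions), and put $a(u,v)=\int_\Omega\int_\Omega v(x)k(x,y)u(y)\,dy\,dx$ and $(u,v)_0=\int_\Omega uv\,dx$, $\|u\|_0=(u,u)_0^{1/2}$. For every $h$ in a set $H\subset(0,\infty)$ of discretisation parameters let $V_h\subset L^2(\Omega)$ be a finite-dimensional subspace with basis $(\varphi^{(h)}_i)_{i=1}^{N_h}$, and assume that $\lim_{h\to0,\,h\in H}\inf_{v\in V_h}\|u-v\|_0=0$ for every $u\in L^2(\Omega)$. The discrete eigenvalue problem is $K^{(h)}x=\lambda M^{(h)}x$, $x\in\mathbb R^{N_h}\setminus\{0\}$, with $K^{(h)}_{il}=a(\varphi^{(h)}_l,\varphi^{(h)}_i)$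 and $M^{(h)}_{il}=(\varphi^{(h)}_l,\varphi^{(h)}_i)_0$; the discrete eigenfunction belonging to an eigenvector $x$ is $\sum_i x_i\varphi^{(h)}_i\in V_h$. For $j\ge1$ let $\lambda^+_j$ (resp. $\lambda^-_j$) be the $j$-th largest positive (resp. $j$-th smallest negative) eigenvalue of $A$ on $L^2(\Omega)$, counted with multiplicity, with the convention that it is $0$ if there are fewer than $j$ positive (resp. negative) eigenvalues; define $\lambda^{+,(h)}_j$ and $\lambda^{-,(h)}_j$ in the same way for the discrete problem. Then for every $j\ge1$: (i) $\lambda^{+,(h)}_j\to\lambda^+_j$ and $\lambda^{-,(h)}_j\to\lambda^-_j$ as $h\to0$, $h\in H$. (ii) If $\lambda^+_j>0$, and if for every $h\in H$ with $\lambda_j^{+,(h)}>0$ (by (i), all sufficiently small $h\in H$) $u^{+,(h)}_j\in V_h$ is a discrete eigenfunction for $\lambda_j^{+,(h)}$ with $\|u^{+,(h)}_j\|_0=1$, then for every sequence $h_n\to0$ in $H$ there is a subsequence along which $u^{+,(h_n)}_j$ converges in $L^2(\Omega)$ to an eigenfunction of $A$ for the eigenvalue $\lambda^+_j$. The analogous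 statement holds for $\lambda^-_j<0$. -/

import Mathlib

open MeasureTheory Filter Topology

noncomputable section

/-- A kernel is continuous on `Ω` if it lies in `C⁰` of (closure of `Ω`) × (closure of `Ω`).
Only the values of `k` on that set matter. -/
def IsContinuousKernel {d : ℕ} (Ω : Set (EuclideanSpace ℝ (Fin d)))
    (k : EuclideanSpace ℝ (Fin d) → EuclideanSpace ℝ (Fin d) → ℝ) : Prop :=
  ContinuousOn (fun p : EuclideanSpace ℝ (Fin d) × EuclideanSpace ℝ (Fin d) => k p.1 p.2)
    (closure Ω ×ˢ closure Ω)

/-- Weakly singular kernels with exponent `α` (the range of `α` is prescribed where this is used). -/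
def IsWeaklySingularKernel {d : ℕ} (Ω : Set (EuclideanSpace ℝ (Fin d)))
    (k : EuclideanSpace ℝ (Fin d) → EuclideanSpace ℝ (Fin d) → ℝ) (α : ℝ) : Prop :=
  ContinuousOn (fun p : EuclideanSpace ℝ (Fin d) × EuclideanSpace ℝ (Fin d) => k p.1 p.2)
    {p | p.1 ∈ closure Ω ∧ p.2 ∈ closure Ω ∧ p.1 ≠ p.2} ∧
  ∃ C : ℝ, 0 < C ∧ ∀ x ∈ closure Ω, ∀ y ∈ closure Ω, x ≠ y → |k x y| ≤ C * ‖x - y‖ ^ (-α)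

def IsSymmetricKernel {d : ℕ} (Ω : Set (EuclideanSpace ℝ (Fin d)))
    (k : EuclideanSpace ℝ (Fin d) → EuclideanSpace ℝ (Fin d) → ℝ) : Prop :=
  ∀ x ∈ closure Ω, ∀ y ∈ closure Ω, x ≠ y → k x y = k y x

/-- The real Hilbert space `L²(Ω)` with respect to Lebesgue measure. -/
abbrev L2On {d : ℕ} (Ω : Set (EuclideanSpace ℝ (Fin d))) : Type :=
  Lp ℝ 2 (volume.restrict Ω)

/-- The function `(A u)(x) = ∫_Ω k(x,y) u(y) dy`. -/
def integralOp {d : ℕ} (Ω : Set (EuclideanSpace ℝ (Fin d)))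
    (k : EuclideanSpace ℝ (Fin d) → EuclideanSpace ℝ (Fin d) → ℝ) (u : L2On Ω) :
    EuclideanSpace ℝ (Fin d) → ℝ :=
  fun x => ∫ y in Ω, k x y * u y

/-- `u` is an eigenfunction of `A` for the eigenvalue `lam`: `u ≠ 0` and `A u = lam u`
as elements of `L²(Ω)`. -/
def IsEigenfunction {d : ℕ} (Ω : Set (EuclideanSpace ℝ (Fin d)))
    (k : EuclideanSpace ℝ (Fin d) → EuclideanSpace ℝ (Fin d) → ℝ) (lam : ℝ) (u : L2On Ω) : Prop :=
  u ≠ 0 ∧ integralOp Ω k u =ᵐ[volume.restrict Ω] fun x => lam * u x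

/-- The bilinear form `a(u,v) = ∫_Ω ∫_Ω v(x) k(x,y) u(y) dy dx`. -/
def kernelForm {d : ℕ} (Ω : Set (EuclideanSpace ℝ (Fin d)))
    (k : EuclideanSpace ℝ (Fin d) → EuclideanSpace ℝ (Fin d) → ℝ) (u v : L2On Ω) : ℝ :=
  ∫ x in Ω, ∫ y in Ω, v x * k x y * u y

/-- `K = (a(φ_j, φ_i))_{i,j}`. -/
def stiffnessMatrix {d : ℕ} (Ω : Set (EuclideanSpace ℝ (Fin d)))
    (k : EuclideanSpace ℝ (Fin d) → EuclideanSpace ℝ (Fin d) → ℝ) {N : ℕ}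
    (φ : Fin N → L2On Ω) : Matrix (Fin N) (Fin N) ℝ :=
  Matrix.of fun i j => kernelForm Ω k (φ j) (φ i)

/-- `M = ((φ_j, φ_i)₀)_{i,j}`. -/
def massMatrix {d : ℕ} (Ω : Set (EuclideanSpace ℝ (Fin d))) {N : ℕ}
    (φ : Fin N → L2On Ω) : Matrix (Fin N) (Fin N) ℝ :=
  Matrix.of fun i j => inner ℝ (φ j) (φ i)

/-- `x` is an eigenvector of the discrete problem: `x ≠ 0` and `K x = lam M x`. -/
def IsDiscreteEigenvector {d : ℕ} (Ω : Set (EuclideanSpace ℝ (Fin d)))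
    (k : EuclideanSpace ℝ (Fin d) → EuclideanSpace ℝ (Fin d) → ℝ) {N : ℕ}
    (φ : Fin N → L2On Ω) (lam : ℝ) (x : Fin N → ℝ) : Prop :=
  x ≠ 0 ∧ (stiffnessMatrix Ω k φ).mulVec x = lam • (massMatrix Ω φ).mulVec x

/-- The prolongation `x ↦ ∑ i, x i φ_i`. -/
def prolong {d : ℕ} {Ω : Set (EuclideanSpace ℝ (Fin d))} {N : ℕ}
    (φ : Fin N → L2On Ω) (x : Fin N → ℝ) : L2On Ω :=
  ∑ i, x i • φ i

/-- For an eigenproblem on a real vector space `W`, given by the relation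
`P μ e` (`e` is an eigenvector for the eigenvalue `μ`), the `j`-th largest positive eigenvalue
counted with multiplicity (`j = 1, 2, …`): the largest `t > 0` such that at least `j` eigenvalues,
counted with multiplicity, i.e. with linearly independent eigenvectors, are `≥ t`.
It is `0` if there are fewer than `j` positive eigenvalues (`sSup ∅ = 0`). -/
def posEigenvalue {W : Type*} [AddCommGroup W] [Module ℝ W] (P : ℝ → W → Prop) (j : ℕ) : ℝ :=
  sSup {t : ℝ | 0 < t ∧ ∃ (μ : Fin j → ℝ) (e : Fin j → W),
    LinearIndependent ℝ e ∧ ∀ i, t ≤ μ i ∧ P (μ i) (e i)}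

/-- The `j`-th smallest negative eigenvalue counted with multiplicity (`j = 1, 2, …`),
and `0` if there are fewer than `j` negative eigenvalues. -/
def negEigenvalue {W : Type*} [AddCommGroup W] [Module ℝ W] (P : ℝ → W → Prop) (j : ℕ) : ℝ :=
  sInf {t : ℝ | t < 0 ∧ ∃ (μ : Fin j → ℝ) (e : Fin j → W),
    LinearIndependent ℝ e ∧ ∀ i, μ i ≤ t ∧ P (μ i) (e i)}

end

/-!
The integral operator `A` is a symmetric Hilbert-Schmidt operator on `L²(Ω)`, and the discrete
problem is the eigenvalue problem of its compression `P A P`, where `P` is the orthogonal projection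
onto the Galerkin space.  The proof is that `P A P → A` in operator norm, together with the
stability of eigenvalues and eigenvectors of compact symmetric operators under norm convergence.

*Norm convergence.*  For both classes of kernels the sections `k(x, ·)` are bounded in `L²(Ω)`
uniformly in `x`; for weakly singular kernels this is the condition `2 α < d`.  Since
`(A u)(x) = ⟪k(x, ·), u⟫`, the Hilbert-Schmidt estimate gives
`‖A - A P‖² ≤ ∫ ‖k(x, ·) - P k(x, ·)‖² dx`, which tends to `0` by dominated convergence, as `P` tends
strongly to the identity (`tendsto_carlemanOp_comp_starProjection`).  Thus `A` is compact as a limit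
of operators of finite rank, and `‖A - P A P‖ ≤ 2 ‖A - A P‖` by taking adjoints
(`norm_galerkinOp_sub_le`).

*Eigenvalues.*  A compact symmetric operator has `j` independent eigenvectors with eigenvalues
`≥ t > 0` if and only if its Rayleigh quotient is `≥ t` on some `j`-dimensional subspace
(`mul_norm_sq_le_inner_of_mem_span`, `exists_eigenvectors_of_le_inner`).  The second condition
changes by at most `‖T - S‖` in `t` when `T` is replaced by `S`, whence Weyl's inequality
`posEigenvalue_le_add_norm_sub`.  Negative eigenvalues are positive eigenvalues of `-A`.

*Eigenfunctions.*  If `S n → T` in norm, `S n (u n) = μ n • u n`, `‖u n‖ = 1` and `μ n → λ ≠ 0`, then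
`T (u n)` converges along a subsequence by compactness, hence so does `μ n • u n`, and therefore
`u n` (`exists_subseq_tendsto_eigenvector`).
-/

open scoped InnerProductSpace

/-! ### Positive eigenvalues of compact symmetric operators -/

section SpectralTheory

variable {E : Type*} [NormedAddCommGroup E] [InnerProductSpace ℝ E]

/-- `e` is an eigenvector of the bounded operator `T` for the eigenvalue `μ`. -/
def IsEigenpair (T : E →L[ℝ] E) (μ : ℝ) (e : E) : Prop :=
  e ≠ 0 ∧ T e = μ • e

lemma isEigenpair_neg_iff {T : E →L[ℝ] E} {μ : ℝ} {e : E} :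
    IsEigenpair (-T) μ e ↔ IsEigenpair T (-μ) e := by
  simp only [IsEigenpair, neg_apply, neg_smul, neg_eq_iff_eq_neg]

lemma le_opNorm_of_isEigenpair {T : E →L[ℝ] E} {μ : ℝ} {e : E} (h : IsEigenpair T μ e) :
    μ ≤ ‖T‖ := by
  have h1 : |μ| * ‖e‖ ≤ ‖T‖ * ‖e‖ := by
    have := T.le_opNorm e
    rwa [h.2, norm_smul, Real.norm_eq_abs] at this
  exact (le_abs_self μ).trans (le_of_mul_le_mul_right h1 (norm_pos_iff.2 h.1))

lemma inner_apply_self_le (T : E →L[ℝ] E) (x : E) : ⟪T x, x⟫_ℝ ≤ ‖T‖ * ‖x‖ ^ 2 := by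
  calc ⟪T x, x⟫_ℝ ≤ ‖T x‖ * ‖x‖ := real_inner_le_norm _ _
    _ ≤ ‖T‖ * ‖x‖ * ‖x‖ := by gcongr; exact T.le_opNorm x
    _ = ‖T‖ * ‖x‖ ^ 2 := by ring

/-- Eigenvectors of a symmetric operator for different eigenvalues are orthogonal. -/
lemma inner_eq_zero_of_isEigenpair {T : E →L[ℝ] E} (hT : T.IsSymmetric) {μ ν : ℝ} {e f : E}
    (he : T e = μ • e) (hf : T f = ν • f) (hne : μ ≠ ν) : ⟪e, f⟫_ℝ = 0 := by
  have h : ⟪T e, f⟫_ℝ = ⟪e, T f⟫_ℝ := hT e f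
  rw [he, hf, real_inner_smul_left, real_inner_smul_right] at h
  have : (μ - ν) * ⟪e, f⟫_ℝ = 0 := by linarith
  exact (mul_eq_zero.1 this).resolve_left (sub_ne_zero.2 hne)

/-- On the span of eigenvectors with eigenvalues `≥ t` the Rayleigh quotient is `≥ t`.  The form
`⟪(T - t) x, x⟫` is the square of the norm of `∑ c i √(μ i - t) e i`: the mixed terms agree
because eigenvectors with different eigenvalues are orthogonal. -/
lemma mul_norm_sq_le_inner_of_mem_span {T : E →L[ℝ] E} (hT : T.IsSymmetric) {j : ℕ}
    {t : ℝ} {μ : Fin j → ℝ} {e : Fin j → E} (h : ∀ i, t ≤ μ i ∧ T (e i) = μ i • e i)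
    {x : E} (hx : x ∈ Submodule.span ℝ (Set.range e)) :
    t * ‖x‖ ^ 2 ≤ ⟪T x, x⟫_ℝ := by
  obtain ⟨c, rfl⟩ := (Submodule.mem_span_range_iff_exists_fun ℝ).1 hx
  set s : Fin j → ℝ := fun i => √(μ i - t) with hs
  have key : ⟪T (∑ i, c i • e i), ∑ i, c i • e i⟫_ℝ - t * ‖∑ i, c i • e i‖ ^ 2
      = ‖∑ i, (c i * s i) • e i‖ ^ 2 := by
    rw [← real_inner_self_eq_norm_sq, ← real_inner_self_eq_norm_sq, map_sum]
    simp only [sum_inner, inner_sum, map_smul, real_inner_smul_left, real_inner_smul_right,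
      Finset.mul_sum, ← Finset.sum_sub_distrib]
    refine Finset.sum_congr rfl fun i _ => Finset.sum_congr rfl fun l _ => ?_
    rw [(h l).2, real_inner_smul_left]
    by_cases hil : μ l = μ i
    · have h1 : s i * s l = μ l - t := by
        simp only [hs, ← hil]
        exact Real.mul_self_sqrt (sub_nonneg.2 (h l).1)
      linear_combination (-(c i * c l * ⟪e l, e i⟫_ℝ)) * h1
    · rw [inner_eq_zero_of_isEigenpair hT (h l).2 (h i).2 hil]
      ring
  have := sq_nonneg ‖∑ i, (c i * s i) • e i‖
  linarith

/-- If the symmetric operator `T` leaves `G` invariant and `⟪T x, x⟫ ≤ s ‖x‖²` on `G`, then a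
vector of `G` that nearly maximizes the Rayleigh quotient is nearly an eigenvector. -/
lemma norm_sq_sub_le_of_forall_inner_le {T : E →L[ℝ] E} (hT : T.IsSymmetric) {G : Submodule ℝ E}
    (hG : ∀ x ∈ G, T x ∈ G) {s : ℝ} (hs : 0 < s) (hsup : ∀ x ∈ G, ⟪T x, x⟫_ℝ ≤ s * ‖x‖ ^ 2)
    {x : E} (hx : x ∈ G) :
    ‖s • x - T x‖ ^ 2 ≤ (s + ‖T‖) * (s * ‖x‖ ^ 2 - ⟪T x, x⟫_ℝ) := by
  set y := s • x - T x with hy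
  have hyG : y ∈ G := G.sub_mem (G.smul_mem _ hx) (hG x hx)
  have hC : 0 < s + ‖T‖ := by positivity
  -- the nonnegative form `⟪(s - T) z, z⟫` at the minimizer `z` along the line `x + ℝ y`
  set τ := (s + ‖T‖)⁻¹ with hτ
  have hτC : τ * (s + ‖T‖) = 1 := inv_mul_cancel₀ hC.ne'
  have h0 := hsup (x - τ • y) (G.sub_mem hx (G.smul_mem _ hyG))
  have hsymm : ⟪T y, x⟫_ℝ = ⟪T x, y⟫_ℝ := by
    have : ⟪T y, x⟫_ℝ = ⟪y, T x⟫_ℝ := hT y x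
    rw [this, real_inner_comm]
  have hyy : s * ⟪x, y⟫_ℝ - ⟪T x, y⟫_ℝ = ‖y‖ ^ 2 := by
    rw [← real_inner_self_eq_norm_sq]
    conv_rhs => rw [hy, inner_sub_left, real_inner_smul_left]
  have hTy : -⟪T y, y⟫_ℝ ≤ ‖T‖ * ‖y‖ ^ 2 := by
    have := inner_apply_self_le (-T) y
    simpa using this
  rw [map_sub, map_smul, norm_sub_sq_real, inner_sub_left, inner_sub_right, inner_sub_right,
    norm_smul, mul_pow, Real.norm_eq_abs, sq_abs] at h0
  simp only [real_inner_smul_left, real_inner_smul_right] at h0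
  rw [hsymm] at h0
  have h1 : τ ^ 2 * (s * ‖y‖ ^ 2 - ⟪T y, y⟫_ℝ) ≤ τ ^ 2 * ((s + ‖T‖) * ‖y‖ ^ 2) := by
    gcongr; linarith
  have h2 : τ ^ 2 * ((s + ‖T‖) * ‖y‖ ^ 2) = τ * ‖y‖ ^ 2 := by
    rw [sq, mul_assoc, ← mul_assoc τ (s + ‖T‖), hτC, one_mul]
  have h3 : τ * ‖y‖ ^ 2 ≤ s * ‖x‖ ^ 2 - ⟪T x, x⟫_ℝ := by
    have := congrArg (τ * ·) hyy
    nlinarith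
  calc ‖y‖ ^ 2 = (s + ‖T‖) * (τ * ‖y‖ ^ 2) := by rw [← mul_assoc, mul_comm _ τ, hτC, one_mul]
    _ ≤ _ := by gcongr

/-- A compact symmetric operator `T` attains its largest positive Rayleigh quotient on a closed
invariant subspace, at an eigenvector. -/
lemma exists_isEigenpair_of_le_inner {T : E →L[ℝ] E} (hTc : IsCompactOperator T)
    (hT : T.IsSymmetric) {G : Submodule ℝ E} (hGc : IsClosed (G : Set E))
    (hG : ∀ x ∈ G, T x ∈ G) {t : ℝ} (ht : 0 < t) {x₀ : E} (hx₀G : x₀ ∈ G) (hx₀ : x₀ ≠ 0)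
    (hx₀t : t * ‖x₀‖ ^ 2 ≤ ⟪T x₀, x₀⟫_ℝ) :
    ∃ s, t ≤ s ∧ ∃ u ∈ G, IsEigenpair T s u := by
  set R : Set ℝ := {r | ∃ x ∈ G, ‖x‖ = 1 ∧ ⟪T x, x⟫_ℝ = r} with hR
  have hscale : ∀ x ∈ G, x ≠ 0 → ⟪T x, x⟫_ℝ / ‖x‖ ^ 2 ∈ R := by
    intro x hx hx0
    have hn : ‖x‖ ≠ 0 := norm_ne_zero_iff.2 hx0
    refine ⟨‖x‖⁻¹ • x, G.smul_mem _ hx, ?_, ?_⟩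
    · rw [norm_smul, norm_inv, norm_norm, inv_mul_cancel₀ hn]
    · rw [map_smul, real_inner_smul_left, real_inner_smul_right]
      field_simp
  have hbdd : BddAbove R := by
    refine ⟨‖T‖, ?_⟩
    rintro r ⟨x, -, hx1, rfl⟩
    have := inner_apply_self_le T x
    rwa [hx1, one_pow, mul_one] at this
  have hne : R.Nonempty := ⟨_, hscale x₀ hx₀G hx₀⟩
  have hts : t ≤ sSup R := by
    refine le_trans ?_ (le_csSup hbdd (hscale x₀ hx₀G hx₀))
    rw [le_div_iff₀ (by positivity)]
    exact hx₀t
  set s := sSup R with hs_def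
  have hs : 0 < s := ht.trans_le hts
  have hsup : ∀ x ∈ G, ⟪T x, x⟫_ℝ ≤ s * ‖x‖ ^ 2 := by
    intro x hx
    rcases eq_or_ne x 0 with rfl | hx0
    · simp
    · have := le_csSup hbdd (hscale x hx hx0)
      rwa [div_le_iff₀ (by positivity)] at this
  -- a maximizing sequence of unit vectors; its images have a convergent subsequence
  obtain ⟨r, -, hr, hrR⟩ := exists_seq_tendsto_sSup hne hbdd
  choose x hxG hx1 hxr using hrR
  have hsub : Tendsto (fun n => s • x n - T (x n)) atTop (𝓝 0) := by
    rw [tendsto_zero_iff_norm_tendsto_zero]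
    have hsq : Tendsto (fun n => ‖s • x n - T (x n)‖ ^ 2) atTop (𝓝 0) := by
      refine squeeze_zero (fun n => by positivity)
        (fun n => norm_sq_sub_le_of_forall_inner_le hT hG hs hsup (hxG n)) ?_
      have : Tendsto (fun n => (s + ‖T‖) * (s - r n)) atTop (𝓝 ((s + ‖T‖) * (s - s))) :=
        (tendsto_const_nhds.sub hr).const_mul _
      simpa [hx1, hxr] using this
    simpa [Real.sqrt_sq] using hsq.sqrt
  obtain ⟨K, hK, hKs⟩ := hTc.image_closedBall_subset_compact (f := T.toLinearMap) 1
  obtain ⟨y, -, σ, hσ, hy⟩ := hK.tendsto_subseq (x := fun n => T (x n))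
    (fun n => hKs ⟨x n, by simp [hx1], rfl⟩)
  have hx : Tendsto (fun n => x (σ n)) atTop (𝓝 (s⁻¹ • y)) := by
    have h1 := ((hsub.comp hσ.tendsto_atTop).add hy).const_smul s⁻¹
    simpa [Function.comp_def, smul_smul, inv_mul_cancel₀ hs.ne'] using h1
  refine ⟨s, hts, s⁻¹ • y, hGc.mem_of_tendsto hx (Eventually.of_forall fun n => hxG _), ?_, ?_⟩
  · have : Tendsto (fun n => ‖x (σ n)‖) atTop (𝓝 ‖s⁻¹ • y‖) := hx.norm
    simp only [hx1] at this
    rw [← norm_ne_zero_iff, ← tendsto_nhds_unique tendsto_const_nhds this]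
    exact one_ne_zero
  · have h1 : Tendsto (fun n => T (x (σ n))) atTop (𝓝 (T (s⁻¹ • y))) :=
      (T.continuous.tendsto _).comp hx
    rw [smul_smul, mul_inv_cancel₀ hs.ne', one_smul]
    exact tendsto_nhds_unique h1 hy

/-- A subspace of dimension larger than that of `F` contains a nonzero vector orthogonal to `F`. -/
lemma exists_mem_orthogonal_ne_zero {m j : ℕ} (hmj : m < j) (e : Fin m → E) {w : Fin j → E}
    (hw : LinearIndependent ℝ w) :
    ∃ x ∈ Submodule.span ℝ (Set.range w),
      x ≠ 0 ∧ x ∈ (Submodule.span ℝ (Set.range e))ᗮ := by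
  let L : (Fin j → ℝ) →ₗ[ℝ] (Fin m → ℝ) :=
    LinearMap.pi fun i => (innerₛₗ ℝ (e i)).comp (Fintype.linearCombination ℝ w)
  obtain ⟨c, hc, hc0⟩ : ∃ c ∈ LinearMap.ker L, c ≠ 0 :=
    (Submodule.ne_bot_iff _).1 (LinearMap.ker_ne_bot_of_finrank_lt (by simpa using hmj))
  refine ⟨Fintype.linearCombination ℝ w c, ?_, ?_, ?_⟩
  · rw [Fintype.linearCombination_apply]
    exact Submodule.sum_mem _ fun i _ => Submodule.smul_mem _ _ (Submodule.subset_span ⟨i, rfl⟩)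
  · intro h0
    apply hc0
    have := Fintype.linearIndependent_iff.1 hw c (by rwa [Fintype.linearCombination_apply] at h0)
    exact funext this
  · rw [Submodule.mem_orthogonal]
    intro u hu
    induction hu using Submodule.span_induction with
    | mem u hu =>
      obtain ⟨i, rfl⟩ := hu
      exact congrFun (LinearMap.mem_ker.1 hc) i
    | zero => simp
    | add u v _ _ hu hv => rw [inner_add_left, hu, hv, add_zero]
    | smul a u _ hu => rw [real_inner_smul_left, hu, mul_zero]

/-- Min-max principle: if the Rayleigh quotient of a compact symmetric operator is `≥ t > 0` on a
`j`-dimensional subspace, there are `j` independent eigenvectors with eigenvalues `≥ t`.  They are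
found one after the other, in the orthogonal complement of the previous ones. -/
lemma exists_eigenvectors_of_le_inner {T : E →L[ℝ] E} (hTc : IsCompactOperator T)
    (hT : T.IsSymmetric) {j : ℕ} {t : ℝ} (ht : 0 < t) {w : Fin j → E}
    (hw : LinearIndependent ℝ w)
    (hwt : ∀ x ∈ Submodule.span ℝ (Set.range w), t * ‖x‖ ^ 2 ≤ ⟪T x, x⟫_ℝ) :
    ∃ (μ : Fin j → ℝ) (e : Fin j → E),
      LinearIndependent ℝ e ∧ ∀ i, t ≤ μ i ∧ IsEigenpair T (μ i) (e i) := by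
  suffices H : ∀ m ≤ j, ∃ (μ : Fin m → ℝ) (e : Fin m → E),
      LinearIndependent ℝ e ∧ ∀ i, t ≤ μ i ∧ IsEigenpair T (μ i) (e i) from H j le_rfl
  intro m
  induction m with
  | zero => exact fun _ => ⟨Fin.elim0, Fin.elim0, linearIndependent_empty_type, fun i => i.elim0⟩
  | succ m ih =>
    intro hm
    obtain ⟨μ, e, he, hμ⟩ := ih (Nat.le_of_succ_le hm)
    set F := Submodule.span ℝ (Set.range e) with hF
    have hFinv : ∀ x ∈ F, T x ∈ F := by
      intro x hx
      induction hx using Submodule.span_induction with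
      | mem u hu =>
        obtain ⟨i, rfl⟩ := hu
        rw [(hμ i).2.2]
        exact F.smul_mem _ (Submodule.subset_span ⟨i, rfl⟩)
      | zero => rw [map_zero]; exact F.zero_mem
      | add u v _ _ hu hv => rw [map_add]; exact F.add_mem hu hv
      | smul a u _ hu => rw [map_smul]; exact F.smul_mem _ hu
    have hinv : ∀ x ∈ Fᗮ, T x ∈ Fᗮ := by
      intro x hx
      rw [Submodule.mem_orthogonal] at hx ⊢
      intro u hu
      have : ⟪T u, x⟫_ℝ = ⟪u, T x⟫_ℝ := hT u x
      rw [← this]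
      exact hx _ (hFinv u hu)
    obtain ⟨x, hxw, hx0, hxF⟩ := exists_mem_orthogonal_ne_zero hm e hw
    obtain ⟨s, hts, u, huF, hu⟩ := exists_isEigenpair_of_le_inner hTc hT
      (Submodule.isClosed_orthogonal F) hinv ht hxF hx0 (hwt x hxw)
    have hnot : u ∉ F := fun hu' => hu.1 (by
      rw [← inner_self_eq_zero (𝕜 := ℝ)]; exact (Submodule.mem_orthogonal _ _).1 huF u hu')
    refine ⟨Fin.cons s μ, Fin.cons u e, he.finCons hnot, fun i => ?_⟩
    induction i using Fin.cases with
    | zero => exact ⟨hts, hu⟩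
    | succ i => exact hμ i

lemma posEigenvalue_nonneg {W : Type*} [AddCommGroup W] [Module ℝ W] (P : ℝ → W → Prop) (j : ℕ) :
    0 ≤ posEigenvalue P j :=
  Real.sSup_nonneg fun _ ht => ht.1.le

/-- The negative eigenvalues are the positive ones of the problem with reflected spectrum. -/
lemma negEigenvalue_eq_neg_posEigenvalue {W : Type*} [AddCommGroup W] [Module ℝ W]
    (P : ℝ → W → Prop) (j : ℕ) :
    negEigenvalue P j = -posEigenvalue (fun μ e => P (-μ) e) j := by
  rw [negEigenvalue, posEigenvalue, Real.sInf_def]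
  congr 2
  ext t
  simp only [Set.mem_neg, Set.mem_ofPred_eq, neg_lt_zero]
  refine and_congr_right fun _ => ⟨?_, ?_⟩
  · rintro ⟨μ, e, he, h⟩
    exact ⟨-μ, e, he, fun i => ⟨by simpa using neg_le_neg (h i).1, by simpa using (h i).2⟩⟩
  · rintro ⟨μ, e, he, h⟩
    exact ⟨-μ, e, he, fun i => ⟨by simpa using (h i).1, by simpa using (h i).2⟩⟩

/-- The positive eigenvalues of a problem on `W` and of a problem on `E` agree if an injective
linear map matches their eigenvectors and its range contains all eigenvectors of the latter for
positive eigenvalues. -/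
lemma posEigenvalue_eq_of_injective {W : Type*} [AddCommGroup W] [Module ℝ W]
    {P : ℝ → W → Prop} {Q : ℝ → E → Prop} (ι : W →ₗ[ℝ] E) (hι : Function.Injective ι)
    (hPQ : ∀ μ w, P μ w ↔ Q μ (ι w)) (hQ : ∀ μ e, 0 < μ → Q μ e → e ∈ LinearMap.range ι) (j : ℕ) :
    posEigenvalue P j = posEigenvalue Q j := by
  unfold posEigenvalue
  congr 1
  ext t
  simp only [Set.mem_ofPred_eq]
  refine and_congr_right fun ht => ⟨?_, ?_⟩
  · rintro ⟨μ, e, he, h⟩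
    exact ⟨μ, ι ∘ e, he.map' ι (LinearMap.ker_eq_bot.2 hι),
      fun i => ⟨(h i).1, (hPQ _ _).1 (h i).2⟩⟩
  · rintro ⟨μ, e, he, h⟩
    choose w hw using fun i => hQ (μ i) (e i) (ht.trans_le (h i).1) (h i).2
    have hw' : ι ∘ w = e := funext hw
    refine ⟨μ, w, LinearIndependent.of_comp ι (hw' ▸ he), fun i => ⟨(h i).1, ?_⟩⟩
    rw [hPQ, hw]
    exact (h i).2

/-- Weyl's inequality: an eigenvalue moves by at most the norm of the perturbation. -/
lemma posEigenvalue_le_add_norm_sub {T S : E →L[ℝ] E} (hT : T.IsSymmetric)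
    (hSc : IsCompactOperator S) (hS : S.IsSymmetric) {j : ℕ} (hj : 1 ≤ j) :
    posEigenvalue (IsEigenpair T) j ≤ posEigenvalue (IsEigenpair S) j + ‖T - S‖ := by
  refine Real.sSup_le ?_ (add_nonneg (posEigenvalue_nonneg _ _) (norm_nonneg _))
  rintro t ⟨-, μ, e, he, h⟩
  rcases le_or_gt t ‖T - S‖ with hle | hlt
  · linarith [posEigenvalue_nonneg (IsEigenpair S) j]
  · have hw : ∀ x ∈ Submodule.span ℝ (Set.range e),
        (t - ‖T - S‖) * ‖x‖ ^ 2 ≤ ⟪S x, x⟫_ℝ := by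
      intro x hx
      have h1 := mul_norm_sq_le_inner_of_mem_span hT (fun i => ⟨(h i).1, (h i).2.2⟩) hx
      have h2 := inner_apply_self_le (T - S) x
      rw [sub_apply, inner_sub_left] at h2
      linarith
    have hbdd : BddAbove {t : ℝ | 0 < t ∧ ∃ (μ : Fin j → ℝ) (e : Fin j → E),
        LinearIndependent ℝ e ∧ ∀ i, t ≤ μ i ∧ IsEigenpair S (μ i) (e i)} := by
      refine ⟨‖S‖, ?_⟩
      rintro r ⟨-, ν, f, -, hf⟩
      exact (hf ⟨0, hj⟩).1.trans (le_opNorm_of_isEigenpair (hf ⟨0, hj⟩).2)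
    have := le_csSup hbdd
      ⟨sub_pos.2 hlt, exists_eigenvectors_of_le_inner hSc hS (sub_pos.2 hlt) he hw⟩
    rw [posEigenvalue]
    linarith

/-- The positive eigenvalues are continuous along norm convergence of compact symmetric
operators. -/
lemma tendsto_posEigenvalue {β : Type*} {l : Filter β} {T : E →L[ℝ] E} {S : β → E →L[ℝ] E}
    (hTc : IsCompactOperator T) (hT : T.IsSymmetric) (hSc : ∀ b, IsCompactOperator (S b))
    (hS : ∀ b, (S b).IsSymmetric) (hlim : Tendsto S l (𝓝 T)) {j : ℕ} (hj : 1 ≤ j) :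
    Tendsto (fun b => posEigenvalue (IsEigenpair (S b)) j) l
      (𝓝 (posEigenvalue (IsEigenpair T) j)) := by
  rw [tendsto_iff_norm_sub_tendsto_zero] at hlim ⊢
  refine squeeze_zero (fun _ => norm_nonneg _) (fun b => ?_) hlim
  rw [Real.norm_eq_abs, abs_sub_le_iff]
  have h1 := posEigenvalue_le_add_norm_sub (hS b) hTc hT hj
  have h2 := posEigenvalue_le_add_norm_sub hT (hSc b) (hS b) hj
  rw [norm_sub_rev] at h2
  constructor <;> linarith

/-- Normalized eigenvectors of operators `S n` converging in norm to a compact operator `T`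
accumulate at eigenvectors of `T`, if the eigenvalues have a nonzero limit. -/
lemma exists_subseq_tendsto_eigenvector {T : E →L[ℝ] E} (hTc : IsCompactOperator T)
    {S : ℕ → E →L[ℝ] E} (hlim : Tendsto S atTop (𝓝 T)) {lam : ℝ} (hlam : lam ≠ 0) {μ : ℕ → ℝ}
    (hμ : Tendsto μ atTop (𝓝 lam)) {u : ℕ → E}
    (hu : ∀ᶠ n in atTop, S n (u n) = μ n • u n ∧ ‖u n‖ = 1) :
    ∃ σ : ℕ → ℕ, StrictMono σ ∧ ∃ v, IsEigenpair T lam v ∧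
      Tendsto (fun n => u (σ n)) atTop (𝓝 v) := by
  obtain ⟨n₀, hn₀⟩ := eventually_atTop.1 hu
  obtain ⟨K, hK, hKs⟩ := hTc.image_closedBall_subset_compact (f := T.toLinearMap) 1
  obtain ⟨y, -, ρ, hρ, hy⟩ := hK.tendsto_subseq (x := fun n => T (u (n + n₀)))
    (fun n => hKs ⟨_, by simp [(hn₀ (n + n₀) (Nat.le_add_left _ _)).2], rfl⟩)
  set σ : ℕ → ℕ := fun n => ρ n + n₀ with hσ_def
  have hσ : StrictMono σ := hρ.add_const n₀
  have huσ : ∀ n, S (σ n) (u (σ n)) = μ (σ n) • u (σ n) ∧ ‖u (σ n)‖ = 1 :=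
    fun n => hn₀ _ (Nat.le_add_left _ _)
  have hdiff : Tendsto (fun n => S (σ n) (u (σ n)) - T (u (σ n))) atTop (𝓝 0) := by
    rw [tendsto_iff_norm_sub_tendsto_zero] at hlim
    refine squeeze_zero_norm (fun n => ?_) (hlim.comp hσ.tendsto_atTop)
    have := (S (σ n) - T).le_opNorm (u (σ n))
    rwa [(huσ n).2, mul_one] at this
  have hSu : Tendsto (fun n => μ (σ n) • u (σ n)) atTop (𝓝 y) := by
    have := hdiff.add hy
    simp only [zero_add] at this
    refine this.congr fun n => ?_
    rw [← (huσ n).1]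
    exact sub_add_cancel _ _
  have hμσ := hμ.comp hσ.tendsto_atTop
  have huv : Tendsto (fun n => u (σ n)) atTop (𝓝 (lam⁻¹ • y)) := by
    refine ((hμσ.inv₀ hlam).smul hSu).congr' ?_
    filter_upwards [hμσ.eventually_ne hlam] with n hn
    simp only [Function.comp_apply] at hn ⊢
    rw [smul_smul, inv_mul_cancel₀ hn, one_smul]
  refine ⟨σ, hσ, lam⁻¹ • y, ⟨?_, ?_⟩, huv⟩
  · have := huv.norm
    simp only [(huσ _).2] at this
    rw [← norm_ne_zero_iff, ← tendsto_nhds_unique tendsto_const_nhds this]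
    exact one_ne_zero
  · rw [smul_smul, mul_inv_cancel₀ hlam, one_smul]
    exact tendsto_nhds_unique ((T.continuous.tendsto _).comp huv) hy

end SpectralTheory

/-! ### Galerkin compressions -/

section Galerkin

variable {E : Type*} [NormedAddCommGroup E] [InnerProductSpace ℝ E]

/-- The Galerkin compression `P T P` of `T`, where `P` is the orthogonal projection onto `U`. -/
noncomputable def galerkinOp (U : Submodule ℝ E) [U.HasOrthogonalProjection] (T : E →L[ℝ] E) :
    E →L[ℝ] E :=
  U.starProjection ∘L T ∘L U.starProjection

lemma galerkinOp_apply (U : Submodule ℝ E) [U.HasOrthogonalProjection] (T : E →L[ℝ] E) (u : E) :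
    galerkinOp U T u = U.starProjection (T (U.starProjection u)) := rfl

lemma galerkinOp_neg (U : Submodule ℝ E) [U.HasOrthogonalProjection] (T : E →L[ℝ] E) :
    galerkinOp U (-T) = -galerkinOp U T := by
  ext u
  simp [galerkinOp_apply]

lemma isSymmetric_galerkinOp (U : Submodule ℝ E) [U.HasOrthogonalProjection] {T : E →L[ℝ] E}
    (hT : T.IsSymmetric) : (galerkinOp U T).IsSymmetric := by
  intro u v
  change ⟪U.starProjection (T (U.starProjection u)), v⟫_ℝ
    = ⟪u, U.starProjection (T (U.starProjection v))⟫_ℝ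
  rw [U.inner_starProjection_left_eq_right, ← U.inner_starProjection_left_eq_right u]
  exact hT _ _

lemma isCompactOperator_starProjection (U : Submodule ℝ E) [FiniteDimensional ℝ U] :
    IsCompactOperator U.starProjection :=
  (isCompactOperator_of_locallyCompactSpace_rng U.subtypeL).comp_clm U.orthogonalProjectionOnto

lemma isCompactOperator_galerkinOp (U : Submodule ℝ E) [FiniteDimensional ℝ U] (T : E →L[ℝ] E) :
    IsCompactOperator (galerkinOp U T) :=
  (isCompactOperator_starProjection U).comp_clm (T ∘L U.starProjection)

/-- For symmetric `T` the error `T - P T` is the adjoint of `T - T P`, so that the latter controls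
the Galerkin error. -/
lemma norm_galerkinOp_sub_le [CompleteSpace E] (U : Submodule ℝ E) [U.HasOrthogonalProjection]
    {T : E →L[ℝ] E} (hT : T.IsSymmetric) :
    ‖galerkinOp U T - T‖ ≤ 2 * ‖T ∘L U.starProjection - T‖ := by
  have hadj : ContinuousLinearMap.adjoint (T ∘L U.starProjection - T)
      = U.starProjection ∘L T - T := by
    rw [map_sub, ContinuousLinearMap.adjoint_comp, hT.isSelfAdjoint.adjoint_eq,
      (U.starProjection_isSymmetric.isSelfAdjoint).adjoint_eq]
  have hnorm : ‖U.starProjection ∘L T - T‖ = ‖T ∘L U.starProjection - T‖ := by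
    rw [← hadj, LinearIsometryEquiv.norm_map]
  have hsplit : galerkinOp U T - T
      = U.starProjection ∘L (T ∘L U.starProjection - T) + (U.starProjection ∘L T - T) := by
    ext u
    simp [galerkinOp_apply]
  calc ‖galerkinOp U T - T‖
      ≤ ‖U.starProjection ∘L (T ∘L U.starProjection - T)‖ + ‖U.starProjection ∘L T - T‖ := by
        rw [hsplit]; exact norm_add_le _ _
    _ ≤ 1 * ‖T ∘L U.starProjection - T‖ + ‖T ∘L U.starProjection - T‖ := by
        rw [hnorm]
        gcongr
        exact (ContinuousLinearMap.opNorm_comp_le _ _).trans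
          (by gcongr; exact U.starProjection_norm_le)
    _ = 2 * ‖T ∘L U.starProjection - T‖ := by ring

/-- The Galerkin equations `⟪T u - μ u, v⟫ = 0`, tested with a spanning family of `U`, say that
`u ∈ U` is an eigenvector of the compression. -/
lemma galerkinOp_apply_eq_smul_iff {ι : Type*} (f : ι → E)
    [(Submodule.span ℝ (Set.range f)).HasOrthogonalProjection] (T : E →L[ℝ] E) (μ : ℝ) {u : E}
    (hu : u ∈ Submodule.span ℝ (Set.range f)) :
    galerkinOp (Submodule.span ℝ (Set.range f)) T u = μ • u ↔
      ∀ i, ⟪T u, f i⟫_ℝ = μ * ⟪u, f i⟫_ℝ := by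
  set U := Submodule.span ℝ (Set.range f) with hU
  have hPu : U.starProjection u = u := Submodule.starProjection_eq_self_iff.2 hu
  have h1 : galerkinOp U T u = μ • u ↔ T u - μ • u ∈ Uᗮ := by
    rw [← Submodule.starProjection_apply_eq_zero_iff, map_sub, map_smul, hPu, sub_eq_zero,
      galerkinOp_apply, hPu]
  have h2 : T u - μ • u ∈ Uᗮ ↔ ∀ i, ⟪f i, T u - μ • u⟫_ℝ = 0 := by
    rw [Submodule.mem_orthogonal]
    refine ⟨fun h i => h _ (Submodule.subset_span ⟨i, rfl⟩), fun h v hv => ?_⟩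
    induction hv using Submodule.span_induction with
    | mem v hv =>
      obtain ⟨i, rfl⟩ := hv
      exact h i
    | zero => simp
    | add v w _ _ hv hw => rw [inner_add_left, hv, hw, add_zero]
    | smul a v _ hv => rw [real_inner_smul_left, hv, mul_zero]
  rw [h1, h2]
  refine forall_congr' fun i => ?_
  rw [real_inner_comm, inner_sub_left, real_inner_smul_left, sub_eq_zero]

end Galerkin

/-! ### Operators given by a bounded Hilbert-space-valued function -/

section CarlemanOperators

variable {X : Type*} [MeasurableSpace X] {ν : Measure X}
  {E : Type*} [NormedAddCommGroup E] [InnerProductSpace ℝ E]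

lemma norm_sq_eq_integral_sq (f : Lp ℝ 2 ν) : ‖f‖ ^ 2 = ∫ x, f x ^ 2 ∂ν := by
  rw [← real_inner_self_eq_norm_sq, L2.inner_def]
  refine integral_congr_ae (ae_of_all _ fun x => ?_)
  simp only [real_inner_self_eq_norm_sq, Real.norm_eq_abs, sq_abs]

/-- A weakly measurable function becomes strongly measurable by projecting it onto a
finite-dimensional space. -/
lemma aestronglyMeasurable_starProjection (U : Submodule ℝ E) [FiniteDimensional ℝ U]
    {K : X → E} (hK : ∀ u, AEStronglyMeasurable (fun x => ⟪K x, u⟫_ℝ) ν) :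
    AEStronglyMeasurable (fun x => U.starProjection (K x)) ν := by
  let b := stdOrthonormalBasis ℝ U
  have : (fun x => U.starProjection (K x)) = fun x => ∑ i, ⟪K x, b i⟫_ℝ • (b i : E) := by
    funext x
    rw [Submodule.starProjection_apply, b.orthogonalProjectionOnto_apply_eq_sum]
    simp [real_inner_comm]
  rw [this]
  exact Finset.aestronglyMeasurable_fun_sum _ fun i _ => (hK _).smul_const _

variable [IsFiniteMeasure ν]

lemma memLp_inner_of_bounded {K : X → E} {M : ℝ}
    (hK : ∀ u, AEStronglyMeasurable (fun x => ⟪K x, u⟫_ℝ) ν) (hM : ∀ x, ‖K x‖ ≤ M) (u : E) :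
    MemLp (fun x => ⟪K x, u⟫_ℝ) 2 ν :=
  MemLp.of_bound (hK u) (M * ‖u‖) <| ae_of_all _ fun x =>
    (norm_inner_le_norm _ _).trans (by gcongr; exact hM x)

/-- The operator `u ↦ (x ↦ ⟪K x, u⟫)` into `L²`, for a bounded, weakly measurable function `K`. -/
noncomputable def carlemanOp (K : X → E) (M : ℝ)
    (hK : ∀ u, AEStronglyMeasurable (fun x => ⟪K x, u⟫_ℝ) ν) (hM : ∀ x, ‖K x‖ ≤ M) :
    E →L[ℝ] Lp ℝ 2 ν :=
  LinearMap.mkContinuous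
    { toFun := fun u => (memLp_inner_of_bounded hK hM u).toLp _
      map_add' := fun u v => by
        rw [← MemLp.toLp_add]
        refine MemLp.toLp_congr _ _ (ae_of_all _ fun x => ?_)
        exact inner_add_right _ _ _
      map_smul' := fun c u => by
        rw [← MemLp.toLp_const_smul]
        refine MemLp.toLp_congr _ _ (ae_of_all _ fun x => ?_)
        exact real_inner_smul_right _ _ _ }
    ((measureUnivNNReal ν : ℝ) ^ (2 : ENNReal).toReal⁻¹ * |M|) (by
      intro u
      refine (Lp.norm_le_of_ae_bound (C := |M| * ‖u‖) (by positivity) ?_).trans_eq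
        (mul_assoc _ _ _).symm
      filter_upwards [(memLp_inner_of_bounded hK hM u).coeFn_toLp] with x hx
      simp only [LinearMap.coe_mk, AddHom.coe_mk, hx]
      refine (norm_inner_le_norm _ _).trans ?_
      gcongr
      exact (hM x).trans (le_abs_self M))

lemma coeFn_carlemanOp {K : X → E} {M : ℝ}
    (hK : ∀ u, AEStronglyMeasurable (fun x => ⟪K x, u⟫_ℝ) ν) (hM : ∀ x, ‖K x‖ ≤ M) (u : E) :
    carlemanOp K M hK hM u =ᵐ[ν] fun x => ⟪K x, u⟫_ℝ :=
  (memLp_inner_of_bounded hK hM u).coeFn_toLp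

/-- Pythagoras, which makes `‖K x - P (K x)‖` measurable in `x` although `K` is only weakly
measurable. -/
lemma norm_sq_sub_starProjection (U : Submodule ℝ E) [U.HasOrthogonalProjection] (u : E) :
    ‖u - U.starProjection u‖ ^ 2 = ‖u‖ ^ 2 - ‖U.starProjection u‖ ^ 2 := by
  have h : ⟪u - U.starProjection u, U.starProjection u⟫_ℝ = 0 :=
    U.starProjection_inner_eq_zero u _ (U.starProjection_apply_mem u)
  have h2 := norm_add_sq_real (u - U.starProjection u) (U.starProjection u)
  rw [sub_add_cancel, h] at h2
  linarith

/-- Hilbert-Schmidt estimate for the truncation error of `u ↦ (x ↦ ⟪K x, u⟫)`. -/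
lemma norm_carlemanOp_comp_sub_le (U : Submodule ℝ E) [FiniteDimensional ℝ U] {K : X → E} {M : ℝ}
    (hK : ∀ u, AEStronglyMeasurable (fun x => ⟪K x, u⟫_ℝ) ν) (hM : ∀ x, ‖K x‖ ≤ M)
    (hint : Integrable (fun x => ‖K x - U.starProjection (K x)‖ ^ 2) ν) :
    ‖carlemanOp K M hK hM ∘L U.starProjection - carlemanOp K M hK hM‖ ≤
      √(∫ x, ‖K x - U.starProjection (K x)‖ ^ 2 ∂ν) := by
  refine ContinuousLinearMap.opNorm_le_bound _ (Real.sqrt_nonneg _) fun u => ?_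
  refine le_of_sq_le_sq ?_ (by positivity)
  rw [mul_pow, Real.sq_sqrt (integral_nonneg fun x => by positivity), norm_sq_eq_integral_sq,
    ← integral_mul_const]
  refine integral_mono_of_nonneg (ae_of_all _ fun x => sq_nonneg _) (hint.mul_const _) ?_
  have h1 : (carlemanOp K M hK hM ∘L U.starProjection - carlemanOp K M hK hM) u
      = carlemanOp K M hK hM (U.starProjection u - u) := by simp
  rw [h1]
  filter_upwards [coeFn_carlemanOp hK hM (U.starProjection u - u)] with x hx
  rw [hx, inner_sub_right, ← U.inner_starProjection_left_eq_right, ← inner_sub_left, ← mul_pow,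
    ← norm_sub_rev, ← sq_abs]
  gcongr
  exact abs_real_inner_le_norm _ _

/-- If projections onto finite-dimensional spaces converge strongly to the identity, then
composing with them approximates `u ↦ (x ↦ ⟪K x, u⟫)` in operator norm. -/
lemma tendsto_carlemanOp_comp_starProjection {β : Type*} {l : Filter β} [l.IsCountablyGenerated]
    (U : β → Submodule ℝ E) [∀ b, FiniteDimensional ℝ (U b)] {K : X → E} {M : ℝ}
    (hK : ∀ u, AEStronglyMeasurable (fun x => ⟪K x, u⟫_ℝ) ν) (hM : ∀ x, ‖K x‖ ≤ M)
    (hKn : AEStronglyMeasurable (fun x => ‖K x‖) ν)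
    (hU : ∀ u, Tendsto (fun b => ‖u - (U b).starProjection u‖) l (𝓝 0)) :
    Tendsto (fun b => carlemanOp K M hK hM ∘L (U b).starProjection) l
      (𝓝 (carlemanOp K M hK hM)) := by
  have hmeas : ∀ b, AEStronglyMeasurable
      (fun x => ‖K x - (U b).starProjection (K x)‖ ^ 2) ν := by
    intro b
    simp only [norm_sq_sub_starProjection]
    exact (hKn.pow 2).sub ((aestronglyMeasurable_starProjection (U b) hK).norm.pow 2)
  have hbound : ∀ b x, ‖‖K x - (U b).starProjection (K x)‖ ^ 2‖ ≤ M ^ 2 := by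
    intro b x
    rw [Real.norm_of_nonneg (by positivity), norm_sq_sub_starProjection]
    have := pow_le_pow_left₀ (norm_nonneg _) (hM x) 2
    linarith [sq_nonneg ‖(U b).starProjection (K x)‖]
  have hlim : Tendsto (fun b => ∫ x, ‖K x - (U b).starProjection (K x)‖ ^ 2 ∂ν) l
      (𝓝 (∫ _, (0 : ℝ) ∂ν)) := by
    refine tendsto_integral_filter_of_dominated_convergence (fun _ => M ^ 2)
      (Eventually.of_forall hmeas) (Eventually.of_forall fun b => ae_of_all _ (hbound b))
      (integrable_const _) (ae_of_all _ fun x => ?_)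
    simpa using (hU (K x)).pow 2
  rw [tendsto_iff_norm_sub_tendsto_zero]
  refine squeeze_zero (fun _ => norm_nonneg _)
    (fun b => norm_carlemanOp_comp_sub_le (U b) hK hM
      (Integrable.of_bound (hmeas b) (M ^ 2) (ae_of_all _ (hbound b)))) ?_
  simpa using hlim.sqrt

end CarlemanOperators

/-! ### Integral operators with square-integrable symmetric kernels -/

section L2Kernels

variable {X : Type*} [MeasurableSpace X] {ν : Measure X}

/-- A measurable symmetric kernel whose sections are uniformly bounded in `L²(ν)`. -/
structure IsBoundedL2Kernel (ν : Measure X) (κ : X → X → ℝ) (M : ℝ) : Prop where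
  measurable : Measurable (Function.uncurry κ)
  symm : ∀ x y, κ x y = κ y x
  memLp : ∀ x, MemLp (κ x) 2 ν
  integral_le : ∀ x, ∫ y, κ x y ^ 2 ∂ν ≤ M ^ 2
  nonneg : 0 ≤ M

namespace IsBoundedL2Kernel

variable {κ : X → X → ℝ} {M : ℝ}

/-- The section `κ x` as an element of `L²`. -/
noncomputable def kernelSection (h : IsBoundedL2Kernel ν κ M) (x : X) : Lp ℝ 2 ν := (h.memLp x).toLp

lemma inner_kernelSection (h : IsBoundedL2Kernel ν κ M) (x : X) (u : Lp ℝ 2 ν) :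
    ⟪h.kernelSection x, u⟫_ℝ = ∫ y, κ x y * u y ∂ν := by
  rw [L2.inner_def]
  refine integral_congr_ae ?_
  filter_upwards [(h.memLp x).coeFn_toLp] with y hy
  simp only [kernelSection, hy]
  exact mul_comm _ _

lemma norm_kernelSection_sq (h : IsBoundedL2Kernel ν κ M) (x : X) :
    ‖h.kernelSection x‖ ^ 2 = ∫ y, κ x y ^ 2 ∂ν := by
  rw [norm_sq_eq_integral_sq]
  refine integral_congr_ae ?_
  filter_upwards [(h.memLp x).coeFn_toLp] with y hy
  simp only [kernelSection, hy]

lemma norm_kernelSection_le (h : IsBoundedL2Kernel ν κ M) (x : X) : ‖h.kernelSection x‖ ≤ M := by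
  refine le_of_sq_le_sq ?_ h.nonneg
  rw [h.norm_kernelSection_sq]
  exact h.integral_le x

variable [IsFiniteMeasure ν]

lemma stronglyMeasurable_integral_sq (h : IsBoundedL2Kernel ν κ M) :
    StronglyMeasurable fun x => ∫ y, κ x y ^ 2 ∂ν :=
  StronglyMeasurable.integral_prod_right (f := fun x y => κ x y ^ 2)
    (h.measurable.pow_const 2).stronglyMeasurable

lemma stronglyMeasurable_inner_kernelSection (h : IsBoundedL2Kernel ν κ M) (u : Lp ℝ 2 ν) :
    StronglyMeasurable fun x => ⟪h.kernelSection x, u⟫_ℝ := by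
  simp only [h.inner_kernelSection]
  exact StronglyMeasurable.integral_prod_right (f := fun x y => κ x y * u y)
    (h.measurable.mul ((Lp.stronglyMeasurable u).measurable.comp measurable_snd)).stronglyMeasurable

lemma aestronglyMeasurable_norm_kernelSection (h : IsBoundedL2Kernel ν κ M) :
    AEStronglyMeasurable (fun x => ‖h.kernelSection x‖) ν := by
  have : (fun x => ‖h.kernelSection x‖) = fun x => √(∫ y, κ x y ^ 2 ∂ν) := by
    funext x
    rw [← h.norm_kernelSection_sq, Real.sqrt_sq (norm_nonneg _)]
  rw [this]
  exact (h.stronglyMeasurable_integral_sq.measurable.sqrt).aestronglyMeasurable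

/-- The integral operator with kernel `κ` on `L²`. -/
noncomputable def op (h : IsBoundedL2Kernel ν κ M) : Lp ℝ 2 ν →L[ℝ] Lp ℝ 2 ν :=
  carlemanOp h.kernelSection M
    (fun u => (h.stronglyMeasurable_inner_kernelSection u).aestronglyMeasurable)
    h.norm_kernelSection_le

lemma coeFn_op (h : IsBoundedL2Kernel ν κ M) (u : Lp ℝ 2 ν) :
    h.op u =ᵐ[ν] fun x => ∫ y, κ x y * u y ∂ν := by
  filter_upwards [coeFn_carlemanOp
    (fun u => (h.stronglyMeasurable_inner_kernelSection u).aestronglyMeasurable)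
    h.norm_kernelSection_le u] with x hx
  rw [← h.inner_kernelSection]
  exact hx

lemma inner_op (h : IsBoundedL2Kernel ν κ M) (u v : Lp ℝ 2 ν) :
    ⟪h.op u, v⟫_ℝ = ∫ x, ∫ y, v x * κ x y * u y ∂ν ∂ν := by
  rw [L2.inner_def]
  refine integral_congr_ae ?_
  filter_upwards [h.coeFn_op u] with x hx
  simp only [hx, mul_assoc, integral_const_mul]
  rfl

lemma memLp_uncurry (h : IsBoundedL2Kernel ν κ M) :
    MemLp (Function.uncurry κ) 2 (ν.prod ν) := by
  rw [memLp_two_iff_integrable_sq h.measurable.aestronglyMeasurable,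
    integrable_prod_iff (h.measurable.pow_const 2).aestronglyMeasurable]
  refine ⟨ae_of_all _ fun x => (h.memLp x).integrable_sq, ?_⟩
  simp only [Function.uncurry_apply_pair, norm_pow, Real.norm_eq_abs, sq_abs]
  refine Integrable.of_bound h.stronglyMeasurable_integral_sq.aestronglyMeasurable (M ^ 2)
    (ae_of_all _ fun x => ?_)
  rw [Real.norm_of_nonneg (integral_nonneg fun y => sq_nonneg _)]
  exact h.integral_le x

lemma integrable_form (h : IsBoundedL2Kernel ν κ M) (u v : Lp ℝ 2 ν) :
    Integrable (Function.uncurry fun x y => v x * κ x y * u y) (ν.prod ν) := by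
  have huv : MemLp (fun p : X × X => v p.1 * u p.2) 2 (ν.prod ν) := by
    refine (memLp_two_iff_integrable_sq
      ((Lp.aestronglyMeasurable v).comp_fst.mul (Lp.aestronglyMeasurable u).comp_snd)).2 ?_
    simp only [Pi.mul_apply, mul_pow]
    exact (Lp.memLp v).integrable_sq.mul_prod (Lp.memLp u).integrable_sq
  refine (h.memLp_uncurry.integrable_mul huv).congr (ae_of_all _ fun p => ?_)
  simp only [Function.uncurry, Pi.mul_apply]
  ring

lemma isSymmetric_op (h : IsBoundedL2Kernel ν κ M) : h.op.IsSymmetric := by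
  intro u v
  change ⟪h.op u, v⟫_ℝ = ⟪u, h.op v⟫_ℝ
  rw [h.inner_op, real_inner_comm, h.inner_op,
    integral_integral_swap (h.integrable_form u v)]
  refine integral_congr_ae (ae_of_all _ fun x => integral_congr_ae (ae_of_all _ fun y => ?_))
  simp only
  rw [h.symm y x]
  ring

lemma tendsto_op_comp_starProjection (h : IsBoundedL2Kernel ν κ M) {β : Type*} {l : Filter β}
    [l.IsCountablyGenerated] (U : β → Submodule ℝ (Lp ℝ 2 ν)) [∀ b, FiniteDimensional ℝ (U b)]
    (hU : ∀ u, Tendsto (fun b => ‖u - (U b).starProjection u‖) l (𝓝 0)) :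
    Tendsto (fun b => h.op ∘L (U b).starProjection) l (𝓝 h.op) :=
  tendsto_carlemanOp_comp_starProjection U _ _ h.aestronglyMeasurable_norm_kernelSection hU

end IsBoundedL2Kernel

end L2Kernels

/-! ### Continuous and weakly singular kernels -/

section Kernels

variable {d : ℕ} {Ω : Set (EuclideanSpace ℝ (Fin d))}
  {k : EuclideanSpace ℝ (Fin d) → EuclideanSpace ℝ (Fin d) → ℝ}

/-- A symmetric kernel that is continuous on `S`, with its square dominated there by a kernel `g` of
uniformly bounded integrals, becomes a bounded `L²` kernel when it is set to `0` off `S`. -/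
lemma isBoundedL2Kernel_indicator {ν : Measure (EuclideanSpace ℝ (Fin d))}
    {S : Set (EuclideanSpace ℝ (Fin d) × EuclideanSpace ℝ (Fin d))} (hS : MeasurableSet S)
    (hk : ContinuousOn (Function.uncurry k) S)
    (hsymm : ∀ x y, (x, y) ∈ S → (y, x) ∈ S ∧ k x y = k y x)
    {g : EuclideanSpace ℝ (Fin d) → EuclideanSpace ℝ (Fin d) → ℝ} {B : ℝ}
    (hg0 : ∀ x y, 0 ≤ g x y) (hg : ∀ x, Integrable (g x) ν) (hgB : ∀ x, ∫ y, g x y ∂ν ≤ B)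
    (hkg : ∀ x y, (x, y) ∈ S → k x y ^ 2 ≤ g x y) :
    IsBoundedL2Kernel ν (fun x y => S.indicator (Function.uncurry k) (x, y)) √B := by
  have hm : Measurable (S.indicator (Function.uncurry k)) := by
    classical
    rw [← Set.piecewise_eq_indicator]
    exact hk.measurable_piecewise continuousOn_const hS
  have hle : ∀ x y, S.indicator (Function.uncurry k) (x, y) ^ 2 ≤ g x y := by
    intro x y
    by_cases h : (x, y) ∈ S
    · rw [Set.indicator_of_mem h]
      exact hkg x y h
    · rw [Set.indicator_of_notMem h]
      simpa using hg0 x y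
  have hmx : ∀ x, Measurable fun y => S.indicator (Function.uncurry k) (x, y) :=
    fun x => hm.comp measurable_prodMk_left
  refine ⟨hm, fun x y => ?_, fun x => ?_, fun x => ?_, Real.sqrt_nonneg _⟩
  · by_cases h : (x, y) ∈ S
    · rw [Set.indicator_of_mem h, Set.indicator_of_mem (hsymm x y h).1]
      exact (hsymm x y h).2
    · rw [Set.indicator_of_notMem h, Set.indicator_of_notMem fun h' => h (hsymm y x h').1]
  · rw [memLp_two_iff_integrable_sq (hmx x).aestronglyMeasurable]
    refine (hg x).mono' ((hmx x).pow_const 2).aestronglyMeasurable (ae_of_all _ fun y => ?_)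
    rw [Real.norm_of_nonneg (sq_nonneg _)]
    exact hle x y
  · rw [Real.sq_sqrt ((integral_nonneg (hg0 x)).trans (hgB x))]
    exact (integral_mono_of_nonneg (ae_of_all _ fun y => sq_nonneg _) (hg x)
      (ae_of_all _ (hle x))).trans (hgB x)

/-- The diagonal is kept here: for `d = 0` it is not a null set. -/
lemma IsContinuousKernel.exists_isBoundedL2Kernel (hk : IsContinuousKernel Ω k)
    (hΩ_open : IsOpen Ω) (hΩ_bdd : Bornology.IsBounded Ω) (hk_symm : IsSymmetricKernel Ω k) :
    ∃ κ M, IsBoundedL2Kernel (volume.restrict Ω) κ M ∧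
      ∀ x ∈ Ω, ∀ᵐ y ∂volume.restrict Ω, k x y = κ x y := by
  have hcomp : IsCompact (closure Ω ×ˢ closure Ω) :=
    hΩ_bdd.isCompact_closure.prod hΩ_bdd.isCompact_closure
  obtain ⟨C, hC⟩ := hcomp.exists_bound_of_continuousOn hk
  have : IsFiniteMeasure (volume.restrict Ω) := ⟨by simpa using hΩ_bdd.measure_lt_top⟩
  have hsub : Ω ×ˢ Ω ⊆ closure Ω ×ˢ closure Ω := Set.prod_mono subset_closure subset_closure
  refine ⟨_, _, isBoundedL2Kernel_indicator (S := Ω ×ˢ Ω) (g := fun _ _ => C ^ 2)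
    (hΩ_open.prod hΩ_open).measurableSet (hk.mono hsub) (fun x y h => ⟨⟨h.2, h.1⟩, ?_⟩)
    (fun _ _ => sq_nonneg C) (fun _ => integrable_const _) (fun _ => le_rfl) (fun x y h => ?_), ?_⟩
  · rcases eq_or_ne x y with rfl | hxy
    · rfl
    · exact hk_symm x (subset_closure h.1) y (subset_closure h.2) hxy
  · rw [← sq_abs]
    exact pow_le_pow_left₀ (abs_nonneg _) (hC (x, y) (hsub h)) 2
  · intro x hx
    filter_upwards [ae_restrict_mem hΩ_open.measurableSet] with y hy
    rw [Set.indicator_of_mem (show (x, y) ∈ Ω ×ˢ Ω from ⟨hx, hy⟩)]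
    rfl

/-- `‖z‖ ^ (-2 α)` is integrable near the origin of `ℝᵈ` for `2 α < d`. -/
lemma integrableOn_ball_norm_rpow {α : ℝ} (hα0 : 0 ≤ α) (hα : α < (d : ℝ) / 2) (R : ℝ) :
    IntegrableOn (fun z : EuclideanSpace ℝ (Fin d) => (‖z‖ ^ (-α)) ^ 2) (Metric.ball 0 R) := by
  have hd : 0 < d := by
    have : (0 : ℝ) < d := by linarith
    exact_mod_cast this
  have : Nonempty (Fin d) := ⟨⟨0, hd⟩⟩
  rcases le_or_gt R 0 with hR | hR
  · simp [Metric.ball_eq_empty.2 hR]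
  rw [integrableOn_fun_norm_addHaar volume (f := fun r : ℝ => (r ^ (-α)) ^ 2),
    finrank_euclideanSpace_fin]
  have hint : IntegrableOn (fun r : ℝ => r ^ ((d : ℝ) - 1 - 2 * α)) (Set.Ioo 0 R) :=
    (intervalIntegral.integrableOn_Ioo_rpow_iff hR).2 (by linarith)
  refine hint.congr_fun (fun r hr => ?_) measurableSet_Ioo
  have hr0 : 0 < r := hr.1
  simp only [smul_eq_mul]
  rw [← Real.rpow_natCast (r ^ (-α)), ← Real.rpow_mul hr0.le, ← Real.rpow_natCast r (d - 1),
    ← Real.rpow_add hr0, Nat.cast_sub (Nat.one_le_iff_ne_zero.2 hd.ne')]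
  congr 1
  push_cast
  ring

/-- The sections are dominated by translates of `C ‖z‖ ^ (-α)`, restricted to a ball of radius larger
than the diameter of `Ω`; the values of `k` on the diagonal are discarded. -/
lemma IsWeaklySingularKernel.exists_isBoundedL2Kernel {α : ℝ}
    (hk : IsWeaklySingularKernel Ω k α) (hα0 : 0 ≤ α) (hα : α < (d : ℝ) / 2)
    (hΩ_open : IsOpen Ω) (hΩ_bdd : Bornology.IsBounded Ω) (hk_symm : IsSymmetricKernel Ω k) :
    ∃ κ M, IsBoundedL2Kernel (volume.restrict Ω) κ M ∧
      ∀ x ∈ Ω, ∀ᵐ y ∂volume.restrict Ω, k x y = κ x y := by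
  obtain ⟨hcont, C, hC, hbound⟩ := hk
  have hd : 0 < d := by
    have : (0 : ℝ) < d := by linarith
    exact_mod_cast this
  have : Nonempty (Fin d) := ⟨⟨0, hd⟩⟩
  obtain ⟨R, hR⟩ := Metric.isBounded_iff.1 hΩ_bdd
  set S : Set (EuclideanSpace ℝ (Fin d) × EuclideanSpace ℝ (Fin d)) :=
    {p | p.1 ∈ Ω ∧ p.2 ∈ Ω ∧ p.1 ≠ p.2} with hS
  have hSm : MeasurableSet S :=
    ((hΩ_open.preimage continuous_fst).inter ((hΩ_open.preimage continuous_snd).inter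
      (isOpen_ne_fun continuous_fst continuous_snd))).measurableSet
  set g₀ : EuclideanSpace ℝ (Fin d) → ℝ :=
    (Metric.ball 0 (R + 1)).indicator fun z => C ^ 2 * (‖z‖ ^ (-α)) ^ 2 with hg₀
  have hg₀_nonneg : ∀ z, 0 ≤ g₀ z := fun z => Set.indicator_nonneg (fun _ _ => by positivity) _
  have hg₀_int : Integrable g₀ :=
    IntegrableOn.integrable_indicator
      ((integrableOn_ball_norm_rpow hα0 hα (R + 1)).const_mul (C ^ 2)) measurableSet_ball
  refine ⟨_, _, isBoundedL2Kernel_indicator (S := S) (g := fun x y => g₀ (x - y))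
    (B := ∫ z, g₀ z) hSm (hcont.mono fun p hp => ⟨subset_closure hp.1, subset_closure hp.2.1, hp.2.2⟩)
    (fun x y h => ⟨⟨h.2.1, h.1, h.2.2.symm⟩,
      hk_symm x (subset_closure h.1) y (subset_closure h.2.1) h.2.2⟩)
    (fun x y => hg₀_nonneg _) (fun x => (hg₀_int.comp_sub_left x).restrict) (fun x => ?_)
    (fun x y h => ?_), ?_⟩
  · calc ∫ y in Ω, g₀ (x - y) ≤ ∫ y, g₀ (x - y) :=
        setIntegral_le_integral (hg₀_int.comp_sub_left x) (ae_of_all _ fun y => hg₀_nonneg _)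
      _ = ∫ z, g₀ z := integral_sub_left_eq_self g₀ volume x
  · have hmem : x - y ∈ Metric.ball (0 : EuclideanSpace ℝ (Fin d)) (R + 1) := by
      rw [mem_ball_zero_iff, ← dist_eq_norm]
      exact (hR h.1 h.2.1).trans_lt (lt_add_one R)
    simp only [hg₀, Set.indicator_of_mem hmem]
    rw [← mul_pow, ← sq_abs]
    exact pow_le_pow_left₀ (abs_nonneg _)
      (hbound x (subset_closure h.1) y (subset_closure h.2.1) h.2.2) 2
  · intro x hx
    -- the diagonal is negligible because `d > 0`
    have hne : ∀ᵐ y ∂volume.restrict Ω, y ≠ x :=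
      ae_restrict_of_ae (Measure.ae_ne volume x)
    filter_upwards [ae_restrict_mem hΩ_open.measurableSet, hne] with y hy hyx
    rw [Set.indicator_of_mem (show (x, y) ∈ S from ⟨hx, hy, hyx.symm⟩)]
    rfl

end Kernels

/-! ### The continuous and the discrete eigenvalue problem as operator problems -/

section Discretization

instance finiteDimensional_span_range {ι E : Type*} [Finite ι] [AddCommGroup E] [Module ℝ E]
    (f : ι → E) : FiniteDimensional ℝ (Submodule.span ℝ (Set.range f)) :=
  FiniteDimensional.span_of_finite ℝ (Set.finite_range f)

variable {d : ℕ} {Ω : Set (EuclideanSpace ℝ (Fin d))}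
  {k κ : EuclideanSpace ℝ (Fin d) → EuclideanSpace ℝ (Fin d) → ℝ} {M : ℝ}

lemma linearCombination_eq_prolong {n : ℕ} (φ : Fin n → L2On Ω) (x : Fin n → ℝ) :
    Fintype.linearCombination ℝ φ x = prolong φ x := rfl

/-- Eigenvectors of the compression for nonzero eigenvalues lie in the Galerkin space, so that the
compression has no further positive eigenvalues than the problem in coordinates. -/
lemma posEigenvalue_eq_galerkinOp {n : ℕ} {φ : Fin n → L2On Ω}
    (hφ : LinearIndependent ℝ φ) {P : ℝ → (Fin n → ℝ) → Prop} {T : L2On Ω →L[ℝ] L2On Ω}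
    (hP : ∀ lam x, P lam x ↔
      IsEigenpair (galerkinOp (Submodule.span ℝ (Set.range φ)) T) lam (prolong φ x)) (j : ℕ) :
    posEigenvalue P j =
      posEigenvalue (IsEigenpair (galerkinOp (Submodule.span ℝ (Set.range φ)) T)) j := by
  refine posEigenvalue_eq_of_injective (Fintype.linearCombination ℝ φ)
    hφ.fintypeLinearCombination_injective hP (fun μ e hμ he => ?_) j
  rw [Fintype.range_linearCombination]
  have h1 : μ • e ∈ Submodule.span ℝ (Set.range φ) := by
    rw [← he.2]
    exact Submodule.starProjection_apply_mem _ _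
  simpa [smul_smul, inv_mul_cancel₀ hμ.ne'] using Submodule.smul_mem _ μ⁻¹ h1

variable [IsFiniteMeasure (volume.restrict Ω)]

lemma integralOp_ae_eq_op (hΩ : MeasurableSet Ω) (h : IsBoundedL2Kernel (volume.restrict Ω) κ M)
    (hkκ : ∀ x ∈ Ω, ∀ᵐ y ∂volume.restrict Ω, k x y = κ x y) (u : L2On Ω) :
    integralOp Ω k u =ᵐ[volume.restrict Ω] h.op u := by
  filter_upwards [h.coeFn_op u, ae_restrict_mem hΩ] with x hx hxΩ
  rw [hx]
  refine integral_congr_ae ?_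
  filter_upwards [hkκ x hxΩ] with y hy
  rw [hy]

lemma isEigenfunction_iff (hΩ : MeasurableSet Ω) (h : IsBoundedL2Kernel (volume.restrict Ω) κ M)
    (hkκ : ∀ x ∈ Ω, ∀ᵐ y ∂volume.restrict Ω, k x y = κ x y) (lam : ℝ) (u : L2On Ω) :
    IsEigenfunction Ω k lam u ↔ IsEigenpair h.op lam u := by
  refine and_congr_right fun _ => ?_
  have h1 := integralOp_ae_eq_op hΩ h hkκ u
  have h2 : (lam • u : L2On Ω) =ᵐ[volume.restrict Ω] fun x => lam * u x := Lp.coeFn_smul lam u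
  rw [Lp.ext_iff]
  exact ⟨fun H => (h1.symm.trans H).trans h2.symm, fun H => (h1.trans H).trans h2⟩

lemma kernelForm_eq_inner (hΩ : MeasurableSet Ω) (h : IsBoundedL2Kernel (volume.restrict Ω) κ M)
    (hkκ : ∀ x ∈ Ω, ∀ᵐ y ∂volume.restrict Ω, k x y = κ x y) (u v : L2On Ω) :
    kernelForm Ω k u v = ⟪h.op u, v⟫_ℝ := by
  rw [h.inner_op]
  refine setIntegral_congr_fun hΩ fun x hx => integral_congr_ae ?_
  filter_upwards [hkκ x hx] with y hy
  rw [hy]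

/-- The matrix eigenvalue problem is the eigenvalue problem of the Galerkin compression. -/
lemma isDiscreteEigenvector_iff (hΩ : MeasurableSet Ω)
    (h : IsBoundedL2Kernel (volume.restrict Ω) κ M)
    (hkκ : ∀ x ∈ Ω, ∀ᵐ y ∂volume.restrict Ω, k x y = κ x y) {n : ℕ} {φ : Fin n → L2On Ω}
    (hφ : LinearIndependent ℝ φ) (lam : ℝ) (x : Fin n → ℝ) :
    IsDiscreteEigenvector Ω k φ lam x ↔
      IsEigenpair (galerkinOp (Submodule.span ℝ (Set.range φ)) h.op) lam (prolong φ x) := by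
  have hmem : prolong φ x ∈ Submodule.span ℝ (Set.range φ) :=
    (Submodule.mem_span_range_iff_exists_fun ℝ).2 ⟨x, rfl⟩
  refine and_congr (not_congr ?_) ?_
  · rw [← linearCombination_eq_prolong, map_eq_zero_iff _ hφ.fintypeLinearCombination_injective]
  · rw [galerkinOp_apply_eq_smul_iff φ _ _ hmem, funext_iff]
    refine forall_congr' fun i => ?_
    simp only [Matrix.mulVec, dotProduct, stiffnessMatrix, massMatrix, Matrix.of_apply,
      Pi.smul_apply, smul_eq_mul, prolong, map_sum, map_smul, sum_inner, real_inner_smul_left,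
      kernelForm_eq_inner hΩ h hkκ]
    simp only [mul_comm]

end Discretization

/-! ### Convergence of eigenvalues and eigenfunctions -/

/-- Along `h → 0` in `H`, normalized eigenvectors for the `j`-th positive eigenvalue accumulate at
eigenvectors of the limit operator, if its `j`-th positive eigenvalue exists.  The hypothesis on
`u h` is empty for those `h` where `S h` has fewer than `j` positive eigenvalues. -/
lemma exists_subseq_tendsto_posEigenvector {E : Type*} [NormedAddCommGroup E]
    [InnerProductSpace ℝ E] {H : Set ℝ} {T : E →L[ℝ] E} {S : ℝ → E →L[ℝ] E}
    (hTc : IsCompactOperator T) (hT : T.IsSymmetric) (hSc : ∀ h, IsCompactOperator (S h))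
    (hS : ∀ h, (S h).IsSymmetric) (hlim : Tendsto S (𝓝[H] 0) (𝓝 T)) {j : ℕ} (hj : 1 ≤ j)
    (hpos : 0 < posEigenvalue (IsEigenpair T) j) {u : ℝ → E}
    (hu : ∀ h ∈ H, 0 < posEigenvalue (IsEigenpair (S h)) j →
      IsEigenpair (S h) (posEigenvalue (IsEigenpair (S h)) j) (u h) ∧ ‖u h‖ = 1)
    {hs : ℕ → ℝ} (hsH : ∀ n, hs n ∈ H) (hs0 : Tendsto hs atTop (𝓝 0)) :
    ∃ σ : ℕ → ℕ, StrictMono σ ∧ ∃ v, IsEigenpair T (posEigenvalue (IsEigenpair T) j) v ∧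
      Tendsto (fun n => u (hs (σ n))) atTop (𝓝 v) := by
  have hs' : Tendsto hs atTop (𝓝[H] 0) :=
    tendsto_nhdsWithin_iff.2 ⟨hs0, Eventually.of_forall hsH⟩
  have hev := (tendsto_posEigenvalue hTc hT hSc hS hlim hj).comp hs'
  refine exists_subseq_tendsto_eigenvector hTc (hlim.comp hs') hpos.ne' hev (u := u ∘ hs) ?_
  filter_upwards [hev.eventually_const_lt hpos] with n hn
  exact ⟨(hu _ (hsH n) hn).1.2, (hu _ (hsH n) hn).2⟩

theorem theorem2 {d : ℕ} (Ω : Set (EuclideanSpace ℝ (Fin d)))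
    (hΩ_open : IsOpen Ω) (hΩ_bdd : Bornology.IsBounded Ω)
    (k : EuclideanSpace ℝ (Fin d) → EuclideanSpace ℝ (Fin d) → ℝ)
    (hk : IsContinuousKernel Ω k ∨
      ∃ α : ℝ, 0 ≤ α ∧ α < (d : ℝ) / 2 ∧ IsWeaklySingularKernel Ω k α)
    (hk_symm : IsSymmetricKernel Ω k)
    -- the admissible discretisation parameters, e.g. all `h > 0` or a sequence of mesh widths
    (H : Set ℝ) (hH : H ⊆ Set.Ioi 0)
    -- the bases of the Galerkin spaces
    (N : ℝ → ℕ) (φ : (h : ℝ) → Fin (N h) → L2On Ω)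
    (hφ : ∀ h ∈ H, LinearIndependent ℝ (φ h))
    -- the Galerkin spaces and the approximation property
    (V : ℝ → Submodule ℝ (L2On Ω)) (hV : ∀ h ∈ H, V h = Submodule.span ℝ (Set.range (φ h)))
    (happrox : ∀ u : L2On Ω,
      Tendsto (fun h => ⨅ v : V h, ‖u - (v : L2On Ω)‖) (𝓝[H] 0) (𝓝 0)) :
    ∀ j : ℕ, 1 ≤ j →
      -- convergence of the eigenvalues
      (Tendsto (fun h => posEigenvalue (IsDiscreteEigenvector Ω k (φ h)) j) (𝓝[H] 0)
        (𝓝 (posEigenvalue (IsEigenfunction Ω k) j)) ∧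
      Tendsto (fun h => negEigenvalue (IsDiscreteEigenvector Ω k (φ h)) j) (𝓝[H] 0)
        (𝓝 (negEigenvalue (IsEigenfunction Ω k) j))) ∧
      -- subsequential convergence of the eigenfunctions, positive eigenvalues
      (0 < posEigenvalue (IsEigenfunction Ω k) j →
        ∀ x : (h : ℝ) → Fin (N h) → ℝ,
          (∀ h ∈ H, 0 < posEigenvalue (IsDiscreteEigenvector Ω k (φ h)) j →
            IsDiscreteEigenvector Ω k (φ h)
              (posEigenvalue (IsDiscreteEigenvector Ω k (φ h)) j) (x h) ∧
            ‖prolong (φ h) (x h)‖ = 1) →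
          ∀ hs : ℕ → ℝ, (∀ n, hs n ∈ H) → Tendsto hs atTop (𝓝 0) →
            ∃ σ : ℕ → ℕ, StrictMono σ ∧ ∃ u : L2On Ω,
              IsEigenfunction Ω k (posEigenvalue (IsEigenfunction Ω k) j) u ∧
              Tendsto (fun n => prolong (φ (hs (σ n))) (x (hs (σ n)))) atTop (𝓝 u)) ∧
      -- subsequential convergence of the eigenfunctions, negative eigenvalues
      (negEigenvalue (IsEigenfunction Ω k) j < 0 →
        ∀ x : (h : ℝ) → Fin (N h) → ℝ,
          (∀ h ∈ H, negEigenvalue (IsDiscreteEigenvector Ω k (φ h)) j < 0 →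
            IsDiscreteEigenvector Ω k (φ h)
              (negEigenvalue (IsDiscreteEigenvector Ω k (φ h)) j) (x h) ∧
            ‖prolong (φ h) (x h)‖ = 1) →
          ∀ hs : ℕ → ℝ, (∀ n, hs n ∈ H) → Tendsto hs atTop (𝓝 0) →
            ∃ σ : ℕ → ℕ, StrictMono σ ∧ ∃ u : L2On Ω,
              IsEigenfunction Ω k (negEigenvalue (IsEigenfunction Ω k) j) u ∧
              Tendsto (fun n => prolong (φ (hs (σ n))) (x (hs (σ n)))) atTop (𝓝 u)) := by
  have : IsFiniteMeasure (volume.restrict Ω) := ⟨by simpa using hΩ_bdd.measure_lt_top⟩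
  have hΩ := hΩ_open.measurableSet
  obtain ⟨κ, M, hκ, hkκ⟩ : ∃ κ M, IsBoundedL2Kernel (volume.restrict Ω) κ M ∧
      ∀ x ∈ Ω, ∀ᵐ y ∂volume.restrict Ω, k x y = κ x y := by
    rcases hk with hk | ⟨α, hα0, hα, hk⟩
    · exact hk.exists_isBoundedL2Kernel hΩ_open hΩ_bdd hk_symm
    · exact hk.exists_isBoundedL2Kernel hα0 hα hΩ_open hΩ_bdd hk_symm
  intro j hj
  set T := hκ.op with hT_def
  set U : ℝ → Submodule ℝ (L2On Ω) := fun h => Submodule.span ℝ (Set.range (φ h)) with hU_def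
  have hUfin : ∀ h, FiniteDimensional ℝ (U h) := fun h => finiteDimensional_span_range (φ h)
  set S : ℝ → L2On Ω →L[ℝ] L2On Ω := fun h => galerkinOp (U h) T with hS_def
  have hEig : IsEigenfunction Ω k = IsEigenpair T := by
    funext lam u
    exact propext (isEigenfunction_iff hΩ hκ hkκ lam u)
  have hEig' : (fun μ => IsEigenpair T (-μ)) = IsEigenpair (-T) := by
    funext μ u
    exact propext isEigenpair_neg_iff.symm
  have hneg : negEigenvalue (IsEigenpair T) j = -posEigenvalue (IsEigenpair (-T)) j := by
    rw [negEigenvalue_eq_neg_posEigenvalue, ← hEig']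
  have hdisc : ∀ h ∈ H, ∀ lam x, IsDiscreteEigenvector Ω k (φ h) lam x ↔
      IsEigenpair (S h) lam (prolong (φ h) x) :=
    fun h hh => isDiscreteEigenvector_iff hΩ hκ hkκ (hφ h hh)
  have hdisc_pos : ∀ h ∈ H, posEigenvalue (IsDiscreteEigenvector Ω k (φ h)) j
      = posEigenvalue (IsEigenpair (S h)) j :=
    fun h hh => posEigenvalue_eq_galerkinOp (hφ h hh) (hdisc h hh) j
  have hdisc_neg : ∀ h ∈ H, negEigenvalue (IsDiscreteEigenvector Ω k (φ h)) j
      = -posEigenvalue (IsEigenpair (-S h)) j := by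
    intro h hh
    rw [negEigenvalue_eq_neg_posEigenvalue, hS_def, ← galerkinOp_neg]
    congr 1
    refine posEigenvalue_eq_galerkinOp (hφ h hh) (fun lam x => ?_) j
    rw [galerkinOp_neg, isEigenpair_neg_iff]
    exact hdisc h hh _ x
  rw [hEig, hneg]
  rcases eq_or_neBot (𝓝[H] (0 : ℝ)) with hbot | hbot
  -- `0` is not an accumulation point of `H`: there are no admissible sequences
  · have hno : ∀ hs : ℕ → ℝ, (∀ n, hs n ∈ H) → ¬ Tendsto hs atTop (𝓝 0) := by
      intro hs hsH hs0
      have := tendsto_nhdsWithin_iff.2 ⟨hs0, Eventually.of_forall hsH⟩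
      rw [hbot] at this
      exact this.neBot.ne rfl
    exact ⟨⟨by simp [hbot], by simp [hbot]⟩, fun _ _ _ hs hsH hs0 => (hno hs hsH hs0).elim,
      fun _ _ _ hs hsH hs0 => (hno hs hsH hs0).elim⟩
  have hproj : ∀ u, Tendsto (fun h => ‖u - (U h).starProjection u‖) (𝓝[H] 0) (𝓝 0) := by
    intro u
    refine (happrox u).congr' ?_
    filter_upwards [self_mem_nhdsWithin] with h hh
    rw [Submodule.starProjection_minimal, hV h hh]
  have hTP := hκ.tendsto_op_comp_starProjection U hproj
  have hTs : T.IsSymmetric := hκ.isSymmetric_op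
  have hTc : IsCompactOperator T := isCompactOperator_of_tendsto hTP
    (Eventually.of_forall fun h => (isCompactOperator_starProjection (U h)).clm_comp T)
  have hSs : ∀ h, (S h).IsSymmetric := fun h => isSymmetric_galerkinOp (U h) hTs
  have hSc : ∀ h, IsCompactOperator (S h) := fun h => isCompactOperator_galerkinOp (U h) T
  have hlim : Tendsto S (𝓝[H] 0) (𝓝 T) := by
    rw [tendsto_iff_norm_sub_tendsto_zero] at hTP ⊢
    refine squeeze_zero (fun _ => norm_nonneg _) (fun h => norm_galerkinOp_sub_le (U h) hTs) ?_
    simpa using hTP.const_mul 2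
  have hTs' : (-T).IsSymmetric := by
    intro u v
    have : ⟪T u, v⟫_ℝ = ⟪u, T v⟫_ℝ := hTs u v
    simpa using this
  have hSs' : ∀ h, (-S h).IsSymmetric := by
    intro h u v
    have : ⟪S h u, v⟫_ℝ = ⟪u, S h v⟫_ℝ := hSs h u v
    simpa using this
  refine ⟨⟨?_, ?_⟩, ?_, ?_⟩
  · refine (tendsto_posEigenvalue hTc hTs hSc hSs hlim hj).congr' ?_
    filter_upwards [self_mem_nhdsWithin] with h hh
    exact (hdisc_pos h hh).symm
  · refine (tendsto_posEigenvalue hTc.neg hTs' (fun h => (hSc h).neg) hSs' hlim.neg hj).neg.congr' ?_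
    filter_upwards [self_mem_nhdsWithin] with h hh
    exact (hdisc_neg h hh).symm
  · intro hpos x hx hs hsH hs0
    refine exists_subseq_tendsto_posEigenvector hTc hTs hSc hSs hlim hj hpos
      (u := fun h => prolong (φ h) (x h)) (fun h hh h0 => ?_) hsH hs0
    have := hx h hh
    rw [hdisc_pos h hh, hdisc h hh] at this
    exact this h0
  · intro hpos x hx hs hsH hs0
    have := exists_subseq_tendsto_posEigenvector hTc.neg hTs' (fun h => (hSc h).neg) hSs' hlim.neg
      hj (neg_lt_zero.1 hpos) (u := fun h => prolong (φ h) (x h)) (fun h hh h0 => ?_) hsH hs0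
    · simpa only [isEigenpair_neg_iff] using this
    · have := hx h hh
      rw [hdisc_neg h hh, hdisc h hh, ← isEigenpair_neg_iff] at this
      exact this (neg_lt_zero.2 h0)
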